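/- Let $d\ge 1$, let $\mathbb B_d$ be the open unit ball of $\mathbb R^d$ with the Euclidean norm $|\cdot|$, let $\ell_d$ be Lebesgue measure, and let $a_d=2\pi^{d/2}/\Gamma(d/2)$ be the area of the unit sphere. Let $\mathrm U_d$ be the spherical uniform distribution on $\mathbb B_d$, i.e. the law of $R\,\theta$ where $\theta$ is uniform on the unit sphere, $R$ is uniform on $(0,1)$, and $\theta$, $R$ are independent. For a convex function $f:\Omega\to\mathbb R$ on an open set $\Omega\subseteq\mathbb R^d$, write $\partial f(x)=\{z\in\mathbb R^d: f(y)-f(x)\ge\langle z,y-x\rangle \text{ for all } y\in\Omega\}$ and $\partial f(E)=\bigcup_{x\in E}\partial f(x)$, and let the Monge–Ampère measure of $f$ be $\mu_f(E)=\ell_d(\partial f(E))$ for Borel $E\subseteq\Omega$. Gradients of convex functions are understood $\ell_d$-almost everywhere. Let $\mathrm P$ be a Borel probability measure on $\mathbb R^d$ with Lebesgue density $p$, supported on an open set $\mathcal X\subseteq\mathbb R^d$ (that is, $\mathrm P(\mathbb R^d\setminus\mathcal X)=0$). Let $\psi:\mathbb B_d\to\mathbb R$ be convex and lower semicontinuous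 with $\psi(0)=0$ and such that $\nabla\psi$ pushes $\mathrm U_d$ forward to $\mathrm P$, and let $\varphi(x)=\sup_{u\in\mathbb B_d}(\langle u,x\rangle-\psi(u))$ for $x\in\mathbb R^d$. Then: (i) $\mu_\varphi$ is absolutely continuous with respect to $\ell_d$ and, for every Borel set $A\subseteq\mathbb R^d$, $$\mu_\varphi(A)=a_d\int_A p(x)\,|\nabla\varphi(x)|^{d-1}\,dx .$$ (ii) If, moreover, $\mathcal X$ is convex and for every $R>0$ there are constants $0<\lambda_R\le\Lambda_R$ with $\lambda_R\le p(x)\le\Lambda_R$ for all $x\in\mathcal X$ with $|x|<R$, then $\mu_\psi$ is absolutely continuous with respect to $\ell_d$ and, for every Borel set $B\subseteq\mathbb B_d$, $$\mu_\psi(B)=\frac1{a_d}\int_B\frac{1}{p(\nabla\psi(y))\,|y|^{d-1}}\,dy ,$$ as an identity in $[0,\infty]$. -/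

import Mathlib

open MeasureTheory Set

noncomputable section

namespace CenterOutward

/-- The Euclidean space of dimension `d`. -/
abbrev E (d : ℕ) : Type := EuclideanSpace ℝ (Fin d)

/-- The open unit ball. -/
def unitBall (d : ℕ) : Set (E d) := Metric.ball 0 1

/-- The area `2 π^(d/2) / Γ(d/2)` of the unit sphere of the Euclidean space of dimension `d`. -/
def sphereArea (d : ℕ) : ℝ := 2 * Real.pi ^ ((d : ℝ) / 2) / Real.Gamma ((d : ℝ) / 2)

/-- The uniform probability on the unit sphere: normalized surface measure. -/
def uniformSphere (d : ℕ) : Measure (Metric.sphere (0 : E d) 1) :=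
  ((volume : Measure (E d)).toSphere univ)⁻¹ • (volume : Measure (E d)).toSphere

/-- The spherical uniform distribution on the unit ball: the law of `r • θ`, where the direction
`θ` is uniform on the unit sphere and the distance `r` to the origin is uniform on `(0, 1)` and
independent of `θ`. -/
def sphericalUniform (d : ℕ) : Measure (E d) :=
  ((uniformSphere d).prod ((volume : Measure ℝ).restrict (Ioo 0 1))).map
    (fun q => q.2 • (q.1 : E d))

/-- The subdifferential at `x` of a real function `f` with domain `Ω`. -/
def subdifferential {d : ℕ} (Ω : Set (E d)) (f : E d → ℝ) (x : E d) : Set (E d) :=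
  {z | ∀ y ∈ Ω, f x + inner ℝ z (y - x) ≤ f y}

/-- The union of the subdifferentials of `f : Ω → ℝ` at the points of `A` (in the domain). -/
def subdifferentialImage {d : ℕ} (Ω : Set (E d)) (f : E d → ℝ) (A : Set (E d)) : Set (E d) :=
  ⋃ x ∈ A ∩ Ω, subdifferential Ω f x

/-- The Monge-Ampère measure of the convex function `f : Ω → ℝ`, as a function of Borel sets. -/
def mongeAmpere {d : ℕ} (Ω : Set (E d)) (f : E d → ℝ) (A : Set (E d)) : ENNReal :=
  volume (subdifferentialImage Ω f A)

/-- The Legendre transform of `ψ`, with the supremum over the open unit ball. For `ψ` convex on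
the ball the supremum is over a nonempty set that is bounded above. -/
def legendre {d : ℕ} (ψ : E d → ℝ) (x : E d) : ℝ :=
  ⨆ u : unitBall d, (inner ℝ (u : E d) x - ψ u)

/-- The function `p` is bounded, and bounded away from zero, on bounded subsets of `X`. -/
def LocallyBoundedDensity {d : ℕ} (X : Set (E d)) (p : E d → ℝ) : Prop :=
  ∀ R : ℝ, 0 < R → ∃ lo hi : ℝ, 0 < lo ∧ lo ≤ hi ∧
    ∀ x ∈ X ∩ Metric.ball 0 R, lo ≤ p x ∧ p x ≤ hi

end CenterOutward

end

/-! Write φ for the Legendre transform of ψ. For u in the ball, u ∈ ∂φ(x) iff x ∈ ∂ψ(u)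
(`mem_subdifferential_legendre_iff`), so up to null sets ∂φ(A) is {∇ψ ∈ A} in the ball and ∂ψ(B) is
contained in {∇φ ∈ B}, with equality for B in the ball. Moreover ∇φ(∇ψ(u)) = u almost everywhere: φ
is Lipschitz, hence differentiable P-a.e.

For (i), Lebesgue measure on the ball is a_d |u|^(d-1) U_d; pushing it forward by ∇ψ, with |u| =
|∇φ(∇ψ(u))|, gives the formula. For (ii), ∂ψ(B) lies in the closure of X, whose frontier is null by
convexity. On X Lebesgue measure is P/p, and P pulls back to U_d, which has density 1/(a_d
|y|^(d-1)). Absolute continuity follows from either formula. -/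

namespace CenterOutward

open Filter Topology
open scoped RealInnerProductSpace ENNReal NNReal

variable {d : ℕ}

/-! ### Subgradients of convex functions -/

/-- At a point of differentiability, the gradient is the only possible subgradient. -/
theorem eq_gradient_of_mem_subdifferential {Ω : Set (E d)} {f : E d → ℝ} {x z : E d}
    (hΩ : Ω ∈ 𝓝 x) (hf : DifferentiableAt ℝ f x) (hz : z ∈ subdifferential Ω f x) :
    z = gradient f x := by
  have hmin : IsLocalMin (fun y => f y - ⟪z, y⟫) x := by
    filter_upwards [hΩ] with y hy
    have h := hz y hy
    rw [inner_sub_right] at h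
    linarith
  have hd : HasFDerivAt (fun y => f y - ⟪z, y⟫) (fderiv ℝ f x - innerSL ℝ z) x :=
    hf.hasFDerivAt.sub (innerSL ℝ z).hasFDerivAt
  have h0 := sub_eq_zero.1 (hmin.hasFDerivAt_eq_zero hd)
  rw [gradient, h0]
  apply (InnerProductSpace.toDual ℝ (E d)).injective
  ext y
  simp

/-- A convex function on an open set has a subgradient at every point. -/
theorem subdifferential_nonempty {Ω : Set (E d)} {f : E d → ℝ} (hΩ : IsOpen Ω)
    (hf : ConvexOn ℝ Ω f) {x : E d} (hx : x ∈ Ω) : (subdifferential Ω f x).Nonempty := by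
  have hcont := hf.continuousOn hΩ
  have hopen : IsOpen {q : E d × ℝ | q.1 ∈ Ω ∧ f q.1 < q.2} := by
    have h1 : ContinuousOn (fun q : E d × ℝ => q.2 - f q.1) (Prod.fst ⁻¹' Ω) :=
      continuousOn_snd.sub (hcont.comp continuousOn_fst fun q hq => hq)
    convert h1.isOpen_inter_preimage (hΩ.preimage continuous_fst) (isOpen_Ioi (a := (0 : ℝ)))
      using 1
    ext q
    simp
  obtain ⟨g, hg⟩ := geometric_hahn_banach_open_point hf.convex_strict_epigraph hopen
    (x := (x, f x)) (by simp)
  set a : ℝ := g (0, 1) with ha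
  have hsplit (y : E d) (t : ℝ) : g (y, t) = g (y, 0) + t * a := by
    have : (y, t) = (y, (0 : ℝ)) + t • ((0 : E d), (1 : ℝ)) := by simp
    rw [this, map_add, map_smul, smul_eq_mul]
  -- The separating hyperplane is not vertical: (x, f x + 1) lies strictly above (x, f x).
  have ha0 : a < 0 := by
    have h := hg (x, f x + 1) ⟨hx, by simp⟩
    rw [hsplit, hsplit x (f x)] at h
    linarith
  let ℓ : StrongDual ℝ (E d) := (-a)⁻¹ • g.comp (ContinuousLinearMap.inl ℝ (E d) ℝ)
  refine ⟨(InnerProductSpace.toDual ℝ (E d)).symm ℓ, fun y hy => ?_⟩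
  rw [InnerProductSpace.toDual_symm_apply]
  have hle : g (y, 0) + f y * a ≤ g (x, 0) + f x * a := by
    refine le_of_forall_pos_lt_add fun ε hε => ?_
    have h := hg (y, f y + ε / (-a)) ⟨hy, by simpa using div_pos hε (neg_pos.2 ha0)⟩
    rw [hsplit, hsplit x (f x), add_mul, div_mul_eq_mul_div] at h
    have : ε * a / -a = -ε := by rw [div_neg, mul_div_cancel_right₀ _ ha0.ne]
    linarith
  have hℓ : ℓ (y - x) = (-a)⁻¹ * (g (y, 0) - g (x, 0)) := by
    have : ((y - x : E d), (0 : ℝ)) = (y, 0) - (x, 0) := by simp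
    change (-a)⁻¹ * g (y - x, 0) = _
    rw [this, map_sub]
  rw [hℓ, ← le_sub_iff_add_le', inv_mul_le_iff₀ (neg_pos.2 ha0)]
  linarith

theorem gradient_mem_subdifferential {Ω : Set (E d)} {f : E d → ℝ} (hΩ : IsOpen Ω)
    (hf : ConvexOn ℝ Ω f) {x : E d} (hx : x ∈ Ω) (hd : DifferentiableAt ℝ f x) :
    gradient f x ∈ subdifferential Ω f x := by
  obtain ⟨z, hz⟩ := subdifferential_nonempty hΩ hf hx
  rwa [← eq_gradient_of_mem_subdifferential (hΩ.mem_nhds hx) hd hz]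

theorem measurable_gradient (f : E d → ℝ) : Measurable (gradient f) :=
  (InnerProductSpace.toDual ℝ (E d)).symm.continuous.measurable.comp (measurable_fderiv ℝ f)

/-- A convex function on an open set is differentiable almost everywhere. -/
theorem ae_differentiableAt_of_convexOn {Ω : Set (E d)} {f : E d → ℝ} (hΩ : IsOpen Ω)
    (hf : ConvexOn ℝ Ω f) : ∀ᵐ x, x ∈ Ω → DifferentiableAt ℝ f x := by
  have key : volume {x | x ∈ Ω ∧ ¬ DifferentiableAt ℝ f x} = 0 := by
    refine measure_null_of_locally_null _ fun x hx => ?_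
    obtain ⟨K, t, ht, hK⟩ := hf.locallyLipschitzOn hΩ hx.1
    rw [hΩ.nhdsWithin_eq hx.1] at ht
    have h0 : volume {y | y ∈ interior t ∧ ¬ DifferentiableAt ℝ f y} = 0 := by
      have := (hK.mono interior_subset).ae_differentiableWithinAt_of_mem (μ := volume)
      rw [ae_iff] at this
      convert this using 2
      ext y
      simp only [mem_ofPred_eq]
      rw [Classical.not_imp]
      refine and_congr_right fun hy => not_congr ?_
      exact ⟨fun h => h.differentiableWithinAt,
        fun h => h.differentiableAt (isOpen_interior.mem_nhds hy)⟩
    refine ⟨_, ?_, h0⟩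
    filter_upwards [self_mem_nhdsWithin, mem_nhdsWithin_of_mem_nhds (interior_mem_nhds.2 ht)]
      with y hy hyt using ⟨hyt, hy.2⟩
  rw [ae_iff]
  simpa only [Classical.not_imp] using key

/-- If the gradient of a convex function lies almost everywhere in a closed convex set, then so do
all subgradients. -/
theorem subdifferential_subset_of_ae_gradient_mem {Ω C : Set (E d)} {f : E d → ℝ}
    (hΩ : IsOpen Ω) (hf : ConvexOn ℝ Ω f) (hC : Convex ℝ C) (hCc : IsClosed C)
    (hgrad : ∀ᵐ u, u ∈ Ω → gradient f u ∈ C) {u : E d} (hu : u ∈ Ω) :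
    subdifferential Ω f u ⊆ C := by
  intro x hx
  by_contra hxC
  obtain ⟨g, c, hgC, hgx⟩ := geometric_hahn_banach_closed_point hC hCc hxC
  set e : E d := (InnerProductSpace.toDual ℝ (E d)).symm g with he
  have hge (y : E d) : g y = ⟪y, e⟫ := by
    rw [real_inner_comm, he, InnerProductSpace.toDual_symm_apply]
  obtain ⟨K, t, ht, hK⟩ := hf.locallyLipschitzOn hΩ hu
  rw [hΩ.nhdsWithin_eq hu] at ht
  obtain ⟨r, hr, hrt⟩ := Metric.mem_nhds_iff.1 (inter_mem ht (hΩ.mem_nhds hu))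
  obtain ⟨s, hs, hsr⟩ : ∃ s : ℝ, 0 < s ∧ s * ‖e‖ < r / 2 := by
    refine ⟨r / 2 / (‖e‖ + 1), by positivity, ?_⟩
    rw [div_mul_eq_mul_div, div_lt_iff₀ (by positivity)]
    nlinarith [norm_nonneg e]
  -- Moving by s along the separating direction e gains at least s (g x - c). Replacing the endpoint
  -- by a nearby good point w costs at most (‖x‖ + K) ‖δ‖, so ε makes the gain win, contradicting
  -- monotonicity of the subdifferential.
  set M : ℝ := ‖x‖ + K + 1 with hM
  have hM0 : 0 < M := by positivity
  set ε : ℝ := min (r / 2) (s * (g x - c) / M) with hε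
  have hε0 : 0 < ε := lt_min (by positivity) (div_pos (mul_pos hs (sub_pos.2 hgx)) hM0)
  have hdense := Measure.dense_of_ae (hgrad.and (ae_differentiableAt_of_convexOn hΩ hf))
  obtain ⟨w, ⟨hwC, hwd⟩, hw⟩ := hdense.exists_dist_lt (u + s • e) hε0
  set δ : E d := w - (u + s • e) with hδ
  have hδε : ‖δ‖ < ε := by rwa [dist_comm, dist_eq_norm] at hw
  have hwu : w - u = s • e + δ := by rw [hδ]; abel
  have hwr : w ∈ Metric.ball u r := by
    rw [mem_ball_iff_norm, hwu]
    calc ‖s • e + δ‖ ≤ ‖s • e‖ + ‖δ‖ := norm_add_le _ _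
      _ < r / 2 + r / 2 := by
        rw [norm_smul, Real.norm_of_nonneg hs.le]
        exact add_lt_add hsr (hδε.trans_le (min_le_left _ _))
      _ = r := by ring
  have hwΩ : w ∈ Ω := (hrt hwr).2
  have htw : t ∈ 𝓝 w :=
    mem_of_superset (Metric.isOpen_ball.mem_nhds hwr) (hrt.trans inter_subset_left)
  set z := gradient f w with hz
  have hzK : ‖z‖ ≤ K := by
    rw [hz, gradient, LinearIsometryEquiv.norm_map]
    exact norm_fderiv_le_of_lipschitzOn ℝ htw hK
  have h1 := gradient_mem_subdifferential hΩ hf hwΩ (hwd hwΩ) u hu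
  have h2 := hx w hwΩ
  rw [← hz, ← neg_sub, inner_neg_right] at h1
  have h3 : ⟪x - z, w - u⟫ ≤ 0 := by rw [inner_sub_left]; linarith
  rw [hwu, inner_add_right, inner_smul_right, inner_sub_left x z e, ← hge, ← hge] at h3
  have h4 : -(‖x‖ + K) * ‖δ‖ ≤ ⟪x - z, δ⟫ := by
    have h5 := neg_le_of_abs_le (abs_real_inner_le_norm (x - z) δ)
    have h6 : ‖x - z‖ * ‖δ‖ ≤ (‖x‖ + K) * ‖δ‖ := by
      gcongr
      exact (norm_sub_le _ _).trans (by linarith)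
    linarith
  have h7 : ‖δ‖ * M < s * (g x - c) :=
    (lt_div_iff₀ hM0).1 (hδε.trans_le (min_le_right _ _))
  have h8 : s * (g x - c) ≤ s * (g x - g z) := by
    gcongr
    exact (hgC z (hwC hwΩ)).le
  rw [hM] at h7
  nlinarith [norm_nonneg δ]

/-! ### Legendre duality on the ball -/

theorem isOpen_unitBall : IsOpen (unitBall d) := Metric.isOpen_ball

theorem zero_mem_unitBall : (0 : E d) ∈ unitBall d := by simp [unitBall]

instance : Nonempty (unitBall d) := ⟨⟨0, zero_mem_unitBall⟩⟩

section Legendre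

variable {ψ : E d → ℝ} (hψ : ConvexOn ℝ (unitBall d) ψ)
include hψ

/-- A subgradient at 0 gives an affine minorant of ψ, and the ball is bounded. -/
theorem bddAbove_legendre (x : E d) :
    BddAbove (range fun u : unitBall d => ⟪(u : E d), x⟫ - ψ u) := by
  obtain ⟨z, hz⟩ := subdifferential_nonempty isOpen_unitBall hψ zero_mem_unitBall
  refine ⟨‖x - z‖ - ψ 0, ?_⟩
  rintro _ ⟨⟨u, hu⟩, rfl⟩
  have h1 := hz u hu
  have h2 : ⟪u, x - z⟫ ≤ ‖x - z‖ := (real_inner_le_norm _ _).trans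
    (mul_le_of_le_one_left (norm_nonneg _) (mem_ball_zero_iff.1 hu).le)
  rw [inner_sub_right] at h2
  rw [sub_zero, real_inner_comm] at h1
  simp only
  linarith

theorem le_legendre (x : E d) {u : E d} (hu : u ∈ unitBall d) :
    ⟪u, x⟫ - ψ u ≤ legendre ψ x :=
  le_ciSup (bddAbove_legendre hψ x) ⟨u, hu⟩

/-- The equality case of the Fenchel–Young inequality. -/
theorem mem_subdifferential_iff_legendre_le {u x : E d} :
    x ∈ subdifferential (unitBall d) ψ u ↔ legendre ψ x ≤ ⟪u, x⟫ - ψ u := by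
  constructor
  · intro h
    refine ciSup_le fun v => ?_
    have := h v v.2
    rw [inner_sub_right, real_inner_comm, real_inner_comm u] at this
    linarith
  · intro h v hv
    have := le_legendre hψ x hv
    rw [inner_sub_right, real_inner_comm, real_inner_comm u]
    linarith

/-- The subdifferentials of a convex function and of its Legendre transform are inverse to each
other. -/
theorem mem_subdifferential_legendre_iff {u x : E d} (hu : u ∈ unitBall d) :
    u ∈ subdifferential univ (legendre ψ) x ↔ x ∈ subdifferential (unitBall d) ψ u := by
  rw [mem_subdifferential_iff_legendre_le hψ]
  constructor
  · intro h
    -- Testing at a subgradient z of ψ at u, where Fenchel–Young is an equality, replaces biduality.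
    obtain ⟨z, hz⟩ := subdifferential_nonempty isOpen_unitBall hψ hu
    rw [mem_subdifferential_iff_legendre_le hψ] at hz
    have := h z (mem_univ z)
    rw [inner_sub_right] at this
    linarith
  · intro h y _
    have := le_legendre hψ y hu
    rw [inner_sub_right]
    linarith

theorem lipschitzWith_legendre : LipschitzWith 1 (legendre ψ) := by
  refine LipschitzWith.of_le_add fun x y => ciSup_le fun u => ?_
  have h1 := le_legendre hψ y u.2
  have h2 : ⟪(u : E d), x - y⟫ ≤ dist x y := by
    rw [dist_eq_norm]
    exact (real_inner_le_norm _ _).trans (mul_le_of_le_one_left (norm_nonneg _)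
      (mem_ball_zero_iff.1 u.2).le)
  rw [inner_sub_right] at h2
  linarith

theorem subdifferential_legendre_subset (x : E d) :
    subdifferential univ (legendre ψ) x ⊆ Metric.closedBall 0 1 := by
  intro u hu
  have h1 := hu (x + u) (mem_univ _)
  have h2 := (lipschitzWith_legendre hψ).dist_le_mul (x + u) x
  rw [add_sub_cancel_left, real_inner_self_eq_norm_sq] at h1
  rw [Real.dist_eq, dist_eq_norm, add_sub_cancel_left, NNReal.coe_one, one_mul] at h2
  rw [mem_closedBall_zero_iff]
  have h3 := le_abs_self (legendre ψ (x + u) - legendre ψ x)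
  nlinarith [norm_nonneg u]

theorem gradient_legendre_gradient {u : E d} (hu : u ∈ unitBall d)
    (hd : DifferentiableAt ℝ ψ u) (hd' : DifferentiableAt ℝ (legendre ψ) (gradient ψ u)) :
    gradient (legendre ψ) (gradient ψ u) = u := by
  refine (eq_gradient_of_mem_subdifferential univ_mem hd' ?_).symm
  rw [mem_subdifferential_legendre_iff hψ hu]
  exact gradient_mem_subdifferential isOpen_unitBall hψ hu hd

/-- The Monge-Ampère measure of the Legendre transform, as the push-forward of the restriction of
the Lebesgue measure to the ball under the gradient. -/
theorem mongeAmpere_legendre (hd : 1 ≤ d) (A : Set (E d)) :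
    mongeAmpere univ (legendre ψ) A = volume (unitBall d ∩ gradient ψ ⁻¹' A) := by
  refine measure_congr ?_
  have : NeZero d := ⟨by omega⟩
  -- Subgradients of the transform may reach the sphere, where duality with ψ is unavailable.
  have hs : ∀ᵐ u : E d, u ∉ Metric.sphere (0 : E d) 1 :=
    measure_eq_zero_iff_ae_notMem.1 (Measure.addHaar_sphere volume 0 1)
  filter_upwards [ae_differentiableAt_of_convexOn isOpen_unitBall hψ, hs] with u hdu hsu
  apply propext
  change u ∈ subdifferentialImage univ (legendre ψ) A ↔ u ∈ unitBall d ∩ gradient ψ ⁻¹' A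
  simp only [subdifferentialImage, inter_univ, mem_iUnion₂, exists_prop]
  constructor
  · rintro ⟨x, hxA, hx⟩
    have hu : u ∈ unitBall d := by
      have h1 := subdifferential_legendre_subset hψ x hx
      rw [← Metric.ball_union_sphere] at h1
      exact h1.resolve_right hsu
    rw [mem_subdifferential_legendre_iff hψ hu] at hx
    refine ⟨hu, ?_⟩
    rw [mem_preimage,
      ← eq_gradient_of_mem_subdifferential (isOpen_unitBall.mem_nhds hu) (hdu hu) hx]
    exact hxA
  · rintro ⟨hu, huA⟩
    refine ⟨_, huA, ?_⟩
    rw [mem_subdifferential_legendre_iff hψ hu]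
    exact gradient_mem_subdifferential isOpen_unitBall hψ hu (hdu hu)

theorem convexOn_legendre : ConvexOn ℝ univ (legendre ψ) := by
  refine ⟨convex_univ, fun x _ y _ a b ha hb hab => ciSup_le fun u => ?_⟩
  have h1 := mul_le_mul_of_nonneg_left (le_legendre hψ x u.2) ha
  have h2 := mul_le_mul_of_nonneg_left (le_legendre hψ y u.2) hb
  rw [inner_add_right, inner_smul_right, inner_smul_right, smul_eq_mul, smul_eq_mul]
  have h3 : ψ u = a * ψ u + b * ψ u := by rw [← add_mul, hab, one_mul]
  linarith

theorem mem_subdifferentialImage_unitBall_iff {B : Set (E d)} {x : E d}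
    (hx : DifferentiableAt ℝ (legendre ψ) x) :
    x ∈ subdifferentialImage (unitBall d) ψ B ↔ gradient (legendre ψ) x ∈ B ∩ unitBall d := by
  simp only [subdifferentialImage, mem_iUnion₂, exists_prop]
  constructor
  · rintro ⟨u, hu, hxu⟩
    have := (mem_subdifferential_legendre_iff hψ hu.2).2 hxu
    rwa [← eq_gradient_of_mem_subdifferential univ_mem hx this]
  · intro h
    refine ⟨_, h, ?_⟩
    rw [← mem_subdifferential_legendre_iff hψ h.2]
    exact gradient_mem_subdifferential isOpen_univ (convexOn_legendre hψ) (mem_univ x) hx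

end Legendre

/-! ### Polar coordinates and the spherical uniform distribution -/

theorem sphereArea_pos (hd : 1 ≤ d) : 0 < sphereArea d := by
  have : (0 : ℝ) < d := by exact_mod_cast hd
  exact div_pos (by positivity) (Real.Gamma_pos_of_pos (by positivity))

theorem toSphere_univ_eq_sphereArea (hd : 1 ≤ d) :
    (volume : Measure (E d)).toSphere univ = ENNReal.ofReal (sphereArea d) := by
  have : NeZero d := ⟨by omega⟩
  have hd0 : (0 : ℝ) < d := by exact_mod_cast hd
  rw [Measure.toSphere_apply_univ, EuclideanSpace.volume_ball, finrank_euclideanSpace,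
    Fintype.card_fin, ENNReal.ofReal_one, one_pow, one_mul, ← ENNReal.ofReal_natCast d,
    ← ENNReal.ofReal_mul hd0.le, sphereArea, Real.Gamma_add_one (by positivity),
    Real.sqrt_eq_rpow, ← Real.rpow_mul_natCast Real.pi_pos.le]
  have := (Real.Gamma_pos_of_pos (half_pos hd0)).ne'
  rw [one_div_mul_eq_div]
  congr 1
  field_simp

/-- Integration over the unit ball in polar coordinates. -/
theorem setLIntegral_unitBall (hd : 1 ≤ d) {g : E d → ℝ≥0∞} (hg : Measurable g) :
    ∫⁻ y in unitBall d, g y =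
      ∫⁻ θ, (∫⁻ r in Ioo (0 : ℝ) 1, ENNReal.ofReal (r ^ (d - 1)) * g (r • (θ : E d)))
        ∂(volume : Measure (E d)).toSphere := by
  have : NeZero d := ⟨by omega⟩
  have hmp := (volume : Measure (E d)).measurePreserving_homeomorphUnitSphereProd
  rw [finrank_euclideanSpace, Fintype.card_fin] at hmp
  set G : E d → ℝ≥0∞ := (unitBall d).indicator g with hG
  have hGm : Measurable G := hg.indicator isOpen_unitBall.measurableSet
  have hGm' : Measurable fun q : Metric.sphere (0 : E d) 1 × Ioi (0 : ℝ) =>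
      G ((q.2 : ℝ) • (q.1 : E d)) := hGm.comp (by fun_prop)
  have h0 : ∫⁻ y, G y = ∫⁻ y : ({0}ᶜ : Set (E d)), G y ∂(volume : Measure (E d)).comap (↑) := by
    rw [lintegral_subtype_comap (measurableSet_singleton _).compl, restrict_compl_singleton]
  have hpolar (x : ({0}ᶜ : Set (E d))) : G x = (fun q : Metric.sphere (0 : E d) 1 × Ioi (0 : ℝ) =>
      G ((q.2 : ℝ) • (q.1 : E d))) (homeomorphUnitSphereProd (E d) x) := by
    have hx : ‖(x : E d)‖ ≠ 0 := norm_ne_zero_iff.2 x.2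
    simp [smul_smul, hx]
  rw [← lintegral_indicator isOpen_unitBall.measurableSet, ← hG, h0, lintegral_congr hpolar]
  have h1 := hmp.lintegral_comp_emb (homeomorphUnitSphereProd (E d)).measurableEmbedding
    fun q => G ((q.2 : ℝ) • (q.1 : E d))
  refine Eq.trans rfl (h1.trans ?_)
  rw [lintegral_prod _ hGm'.aemeasurable]
  refine lintegral_congr fun θ => ?_
  have hθ : Measurable fun r : ℝ => G (r • (θ : E d)) := hGm.comp (by fun_prop)
  rw [Measure.volumeIoiPow]
  refine (lintegral_withDensity_eq_lintegral_mul _ (by fun_prop)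
    (hθ.comp measurable_subtype_coe)).trans ?_
  refine (lintegral_subtype_comap measurableSet_Ioi
    fun r : ℝ => ENNReal.ofReal (r ^ (d - 1)) * G (r • (θ : E d))).trans ?_
  rw [← lintegral_indicator measurableSet_Ioi, ← lintegral_indicator measurableSet_Ioo]
  refine lintegral_congr fun r => ?_
  by_cases hr : 0 < r
  · have hn : ‖r • (θ : E d)‖ = r := by simp [norm_smul, abs_of_pos hr]
    have hmem : r • (θ : E d) ∈ unitBall d ↔ r < 1 := by rw [unitBall, mem_ball_zero_iff, hn]
    by_cases hr1 : r < 1 <;> simp [hG, indicator, hr, hmem, hr1]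
  · simp [indicator, hr]

theorem measurable_smul_sphere :
    Measurable fun q : Metric.sphere (0 : E d) 1 × ℝ => q.2 • (q.1 : E d) := by
  fun_prop

/-- The Lebesgue measure on the ball has density `sphereArea d * ‖y‖ ^ (d - 1)` with respect to the
spherical uniform distribution. -/
theorem setLIntegral_unitBall_eq_sphericalUniform (hd : 1 ≤ d) {g : E d → ℝ≥0∞}
    (hg : Measurable g) :
    ∫⁻ y in unitBall d, g y = ENNReal.ofReal (sphereArea d) *
      ∫⁻ y, ENNReal.ofReal (‖y‖ ^ (d - 1)) * g y ∂sphericalUniform d := by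
  have hpos := sphereArea_pos hd
  rw [setLIntegral_unitBall hd hg, sphericalUniform,
    lintegral_map (by fun_prop) measurable_smul_sphere, uniformSphere, Measure.prod_smul_left,
    lintegral_smul_measure, toSphere_univ_eq_sphereArea hd, smul_eq_mul, ← mul_assoc,
    ENNReal.mul_inv_cancel (by simpa using hpos) ENNReal.ofReal_ne_top, one_mul,
    lintegral_prod _ (Measurable.aemeasurable (by fun_prop))]
  refine lintegral_congr fun θ => setLIntegral_congr_fun measurableSet_Ioo fun r hr => ?_
  have : ‖r • (θ : E d)‖ = r := by simp [norm_smul, abs_of_pos hr.1]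
  simp only [this]

theorem ae_sphericalUniform_ne_zero : ∀ᵐ y ∂sphericalUniform d, y ≠ 0 := by
  have h : sphericalUniform d {0} = 0 := by
    rw [sphericalUniform, Measure.map_apply measurable_smul_sphere (measurableSet_singleton 0)]
    have : (fun q : Metric.sphere (0 : E d) 1 × ℝ => q.2 • (q.1 : E d)) ⁻¹' {0} =
        univ ×ˢ {0} := by
      ext q
      have : (q.1 : E d) ≠ 0 := ne_zero_of_mem_unit_sphere q.1
      simp [this]
    rw [this, Measure.prod_prod]
    simp
  exact measure_eq_zero_iff_ae_notMem.1 h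

/-- The spherical uniform distribution has density `1 / (sphereArea d * ‖y‖ ^ (d - 1))`. -/
theorem sphericalUniform_eq_withDensity (hd : 1 ≤ d) :
    sphericalUniform d = (volume.restrict (unitBall d)).withDensity
      fun y => ENNReal.ofReal (1 / (sphereArea d * ‖y‖ ^ (d - 1))) := by
  have hpos := sphereArea_pos hd
  have hρ : Measurable fun y : E d => ENNReal.ofReal (1 / (sphereArea d * ‖y‖ ^ (d - 1))) := by
    fun_prop
  ext S hS
  rw [withDensity_apply _ hS, ← lintegral_indicator hS,
    setLIntegral_unitBall_eq_sphericalUniform hd (hρ.indicator hS),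
    ← lintegral_const_mul' _ _ ENNReal.ofReal_ne_top, ← lintegral_indicator_one hS]
  refine lintegral_congr_ae ?_
  -- For d ≥ 2 the quotient takes the default value 0 at the origin, so that null point is
  -- discarded.
  filter_upwards [ae_sphericalUniform_ne_zero] with y hy
  by_cases hyS : y ∈ S
  · have hy' : 0 < ‖y‖ ^ (d - 1) := pow_pos (norm_pos_iff.2 hy) _
    simp only [indicator_of_mem hyS, Pi.one_apply]
    rw [← ENNReal.ofReal_mul hy'.le, ← ENNReal.ofReal_mul hpos.le, ← ENNReal.ofReal_one]
    congr 1
    field_simp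
  · simp [hyS]

theorem sphericalUniform_absolutelyContinuous (hd : 1 ≤ d) :
    sphericalUniform d ≪ volume.restrict (unitBall d) := by
  rw [sphericalUniform_eq_withDensity hd]
  exact withDensity_absolutelyContinuous _ _

theorem absolutelyContinuous_sphericalUniform (hd : 1 ≤ d) :
    volume.restrict (unitBall d) ≪ sphericalUniform d := by
  refine Measure.AbsolutelyContinuous.mk fun S hS h0 => ?_
  rw [← lintegral_indicator_one hS, setLIntegral_unitBall_eq_sphericalUniform hd
    (measurable_one.indicator hS)]
  have : (fun y => ENNReal.ofReal (‖y‖ ^ (d - 1)) * S.indicator 1 y)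
      =ᵐ[sphericalUniform d] fun _ => 0 := by
    filter_upwards [measure_eq_zero_iff_ae_notMem.1 h0] with y hy
    simp [hy]
  rw [lintegral_congr_ae this]
  simp

/-! ### Change of variables along the transport -/

section Transport

variable {P : Measure (E d)} {p ψ : E d → ℝ}

theorem ae_sphericalUniform_of_ae_unitBall (hd : 1 ≤ d) {q : E d → Prop}
    (h : ∀ᵐ u, u ∈ unitBall d → q u) : ∀ᵐ u ∂sphericalUniform d, u ∈ unitBall d ∧ q u := by
  refine (sphericalUniform_absolutelyContinuous hd).ae_le ?_
  filter_upwards [(ae_restrict_iff' isOpen_unitBall.measurableSet).2 h,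
    ae_restrict_mem isOpen_unitBall.measurableSet] with u h1 h2 using ⟨h2, h1⟩

/-- Almost everywhere, the gradient of the Legendre transform inverts the gradient. -/
theorem ae_gradient_legendre_gradient (hd : 1 ≤ d) (hψ : ConvexOn ℝ (unitBall d) ψ)
    (hpush : (sphericalUniform d).map (gradient ψ) = P) (hP : P ≪ volume) :
    ∀ᵐ u ∂sphericalUniform d, gradient (legendre ψ) (gradient ψ u) = u := by
  have hdiff : ∀ᵐ x ∂P, DifferentiableAt ℝ (legendre ψ) x :=
    hP.ae_le (lipschitzWith_legendre hψ).ae_differentiableAt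
  rw [← hpush] at hdiff
  filter_upwards [ae_of_ae_map (measurable_gradient ψ).aemeasurable hdiff,
    ae_sphericalUniform_of_ae_unitBall hd (ae_differentiableAt_of_convexOn isOpen_unitBall hψ)]
    with u hu1 hu2
  exact gradient_legendre_gradient hψ hu2.1 hu2.2 hu1

variable (hp : Measurable p) (hP : P = volume.withDensity fun x => ENNReal.ofReal (p x))
  (hψ : ConvexOn ℝ (unitBall d) ψ) (hpush : (sphericalUniform d).map (gradient ψ) = P)
include hp hP hψ hpush

theorem mongeAmpere_legendre_eq (hd : 1 ≤ d) (hp0 : ∀ x, 0 ≤ p x) {A : Set (E d)}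
    (hA : MeasurableSet A) :
    mongeAmpere univ (legendre ψ) A = ENNReal.ofReal (sphereArea d) *
      ∫⁻ x in A, ENNReal.ofReal (p x * ‖gradient (legendre ψ) x‖ ^ (d - 1)) := by
  have hT := measurable_gradient ψ
  have hT' := measurable_gradient (legendre ψ)
  have hac : P ≪ volume := hP ▸ withDensity_absolutelyContinuous _ _
  have hw : Measurable fun x => ENNReal.ofReal (‖gradient (legendre ψ) x‖ ^ (d - 1)) := by
    fun_prop
  rw [mongeAmpere_legendre hψ hd, inter_comm, ← Measure.restrict_apply (hT hA),
    ← lintegral_indicator_one (hT hA),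
    setLIntegral_unitBall_eq_sphericalUniform hd (measurable_one.indicator (hT hA))]
  congr 1
  calc _ = ∫⁻ u, A.indicator (fun x => ENNReal.ofReal (‖gradient (legendre ψ) x‖ ^ (d - 1)))
          (gradient ψ u) ∂sphericalUniform d := by
        refine lintegral_congr_ae ?_
        filter_upwards [ae_gradient_legendre_gradient hd hψ hpush hac] with u hu
        by_cases huA : gradient ψ u ∈ A <;> simp [indicator, huA, hu]
    _ = ∫⁻ x, A.indicator (fun x => ENNReal.ofReal (‖gradient (legendre ψ) x‖ ^ (d - 1))) x ∂P := by
        rw [← hpush, lintegral_map (hw.indicator hA) hT]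
    _ = _ := by
        rw [hP, lintegral_withDensity_eq_lintegral_mul _ (by fun_prop) (hw.indicator hA),
          ← lintegral_indicator hA]
        refine lintegral_congr fun x => ?_
        by_cases hxA : x ∈ A <;> simp [hxA, ENNReal.ofReal_mul (hp0 x)]

omit hp hP in
-- Gradients lie in X for U_d-almost every point, hence Lebesgue-a.e. in the ball; closed convexity
-- passes this to all subgradients.
theorem subdifferentialImage_subset_closure (hd : 1 ≤ d) {X : Set (E d)}
    (hXc : Convex ℝ X) (hPX : P Xᶜ = 0) (B : Set (E d)) :
    subdifferentialImage (unitBall d) ψ B ⊆ closure X := by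
  have h1 : ∀ᵐ x ∂P, x ∈ X := mem_ae_iff.2 hPX
  rw [← hpush] at h1
  have h2 := (ae_restrict_iff' isOpen_unitBall.measurableSet).1
    ((absolutelyContinuous_sphericalUniform hd).ae_le
      (ae_of_ae_map (measurable_gradient ψ).aemeasurable h1))
  refine iUnion₂_subset fun u hu => subdifferential_subset_of_ae_gradient_mem isOpen_unitBall hψ
    hXc.closure isClosed_closure ?_ hu.2
  filter_upwards [h2] with v hv hvB using subset_closure (hv hvB)

theorem mongeAmpere_unitBall_eq (hd : 1 ≤ d) {X : Set (E d)} (hX : IsOpen X)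
    (hXc : Convex ℝ X) (hPX : P Xᶜ = 0) (hpX : ∀ x ∈ X, 0 < p x) {B : Set (E d)}
    (hB : MeasurableSet B) (hBb : B ⊆ unitBall d) :
    mongeAmpere (unitBall d) ψ B = ENNReal.ofReal (1 / sphereArea d) *
      ∫⁻ y in B, ENNReal.ofReal (1 / (p (gradient ψ y) * ‖y‖ ^ (d - 1))) := by
  have hT := measurable_gradient ψ
  have hT' := measurable_gradient (legendre ψ)
  have hac : P ≪ volume := hP ▸ withDensity_absolutelyContinuous _ _
  have hS : MeasurableSet (X ∩ gradient (legendre ψ) ⁻¹' B) := hX.measurableSet.inter (hT' hB)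
  have hinv : Measurable fun x => ENNReal.ofReal (1 / p x) := by fun_prop
  have hae : subdifferentialImage (unitBall d) ψ B =ᵐ[volume]
      (X ∩ gradient (legendre ψ) ⁻¹' B : Set (E d)) := by
    filter_upwards [(lipschitzWith_legendre hψ).ae_differentiableAt (μ := volume),
      measure_eq_zero_iff_ae_notMem.1 (hXc.addHaar_frontier volume)] with x hx hxf
    have h1 := mem_subdifferentialImage_unitBall_iff (B := B) hψ hx
    rw [inter_eq_self_of_subset_left hBb] at h1
    refine propext (h1.trans ⟨fun h => ⟨?_, h⟩, fun h => h.2⟩)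
    have h2 := subdifferentialImage_subset_closure hψ hpush hd hXc hPX B
      (h1.2 h)
    rw [closure_eq_self_union_frontier] at h2
    exact h2.resolve_right hxf
  have hXae : ∀ᵐ x ∂P, x ∈ X := mem_ae_iff.2 hPX
  rw [← hpush] at hXae
  calc mongeAmpere (unitBall d) ψ B = volume (X ∩ gradient (legendre ψ) ⁻¹' B) :=
        measure_congr hae
    _ = ∫⁻ x, (X ∩ gradient (legendre ψ) ⁻¹' B).indicator
          (fun x => ENNReal.ofReal (1 / p x)) x ∂P := by
        rw [hP, lintegral_withDensity_eq_lintegral_mul _ (by fun_prop) (hinv.indicator hS),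
          ← lintegral_indicator_one hS]
        -- On X the factors p and 1/p cancel; this is where positivity of p enters.
        refine lintegral_congr fun x => ?_
        by_cases hx : x ∈ X ∩ gradient (legendre ψ) ⁻¹' B
        · have := hpX x hx.1
          simp only [indicator_of_mem hx, Pi.mul_apply, Pi.one_apply]
          rw [← ENNReal.ofReal_mul this.le, mul_one_div_cancel this.ne', ENNReal.ofReal_one]
        · simp only [indicator_of_notMem hx, Pi.mul_apply, mul_zero]
    _ = ∫⁻ u, B.indicator (fun u => ENNReal.ofReal (1 / p (gradient ψ u))) u
          ∂sphericalUniform d := by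
        rw [← hpush, lintegral_map (hinv.indicator hS) hT]
        refine lintegral_congr_ae ?_
        filter_upwards [ae_gradient_legendre_gradient hd hψ hpush hac,
          ae_of_ae_map hT.aemeasurable hXae] with u hu huX
        by_cases huB : u ∈ B <;> simp [indicator, huB, hu, huX]
    _ = _ := by
        have hm : Measurable fun u => ENNReal.ofReal (1 / p (gradient ψ u)) := hinv.comp hT
        rw [sphericalUniform_eq_withDensity hd,
          lintegral_withDensity_eq_lintegral_mul _ (by fun_prop) (hm.indicator hB),
          ← lintegral_const_mul' _ _ ENNReal.ofReal_ne_top,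
          ← inter_eq_self_of_subset_left hBb, ← Measure.restrict_restrict hB,
          ← lintegral_indicator hB, inter_eq_self_of_subset_left hBb]
        refine lintegral_congr fun u => ?_
        by_cases huB : u ∈ B
        · have ha := (sphereArea_pos hd).le
          simp only [indicator_of_mem huB, Pi.mul_apply]
          -- With the convention 0⁻¹ = 0 the two real densities agree everywhere, even at u = 0.
          rw [← ENNReal.ofReal_mul (by positivity), ← ENNReal.ofReal_mul (by positivity)]
          congr 1
          simp only [one_div, mul_inv]
          ring
        · simp [huB]

end Transport

/-- The local bounds enter (ii) through this positivity, which lets 1/p undo the density on X. -/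
theorem LocallyBoundedDensity.pos {X : Set (E d)} {p : E d → ℝ} (h : LocallyBoundedDensity X p)
    {x : E d} (hx : x ∈ X) : 0 < p x := by
  obtain ⟨lo, hi, hlo, -, hb⟩ := h (‖x‖ + 1) (by positivity)
  exact hlo.trans_le (hb x ⟨hx, by simp⟩).1

end CenterOutward

theorem mainTheorem7 (d : ℕ) (hd : 1 ≤ d)
    (X : Set (CenterOutward.E d)) (hX : IsOpen X)
    (P : Measure (CenterOutward.E d)) [IsProbabilityMeasure P]
    (p : CenterOutward.E d → ℝ) (hp_meas : Measurable p) (hp_nonneg : ∀ x, 0 ≤ p x)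
    (hP_density : P = (volume : Measure (CenterOutward.E d)).withDensity
      (fun x => ENNReal.ofReal (p x)))
    (hP_supp : P Xᶜ = 0)
    (ψ : CenterOutward.E d → ℝ)
    (hψ_convex : ConvexOn ℝ (CenterOutward.unitBall d) ψ)
    (hψ_lsc : LowerSemicontinuousOn ψ (CenterOutward.unitBall d))
    (hψ_zero : ψ 0 = 0)
    (hψ_push : (CenterOutward.sphericalUniform d).map (gradient ψ) = P)
    (φ : CenterOutward.E d → ℝ) (hφ : φ = CenterOutward.legendre ψ) :
    ((∀ A : Set (CenterOutward.E d), MeasurableSet A → volume A = 0 →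
        CenterOutward.mongeAmpere univ φ A = 0) ∧
      (∀ A : Set (CenterOutward.E d), MeasurableSet A →
        CenterOutward.mongeAmpere univ φ A =
          ENNReal.ofReal (CenterOutward.sphereArea d) *
            ∫⁻ x in A, ENNReal.ofReal (p x * ‖gradient φ x‖ ^ (d - 1)))) ∧
    (Convex ℝ X → CenterOutward.LocallyBoundedDensity X p →
      (∀ B : Set (CenterOutward.E d), MeasurableSet B → B ⊆ CenterOutward.unitBall d →
        volume B = 0 → CenterOutward.mongeAmpere (CenterOutward.unitBall d) ψ B = 0) ∧
      (∀ B : Set (CenterOutward.E d), MeasurableSet B → B ⊆ CenterOutward.unitBall d →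
        CenterOutward.mongeAmpere (CenterOutward.unitBall d) ψ B =
          ENNReal.ofReal (1 / CenterOutward.sphereArea d) *
            ∫⁻ y in B, ENNReal.ofReal (1 / (p (gradient ψ y) * ‖y‖ ^ (d - 1))))) := by
  subst hφ
  have h1 {A : Set (CenterOutward.E d)} (hA : MeasurableSet A) :=
    CenterOutward.mongeAmpere_legendre_eq hp_meas hP_density hψ_convex hψ_push hd hp_nonneg hA
  refine ⟨⟨fun A hA h0 => ?_, fun A hA => h1 hA⟩, fun hXc hpX => ?_⟩
  · rw [h1 hA, setLIntegral_measure_zero _ _ h0, mul_zero]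
  have h2 {B : Set (CenterOutward.E d)} (hB : MeasurableSet B)
      (hBb : B ⊆ CenterOutward.unitBall d) :=
    CenterOutward.mongeAmpere_unitBall_eq hp_meas hP_density hψ_convex hψ_push hd hX hXc hP_supp
      (fun x hx => hpX.pos hx) hB hBb
  refine ⟨fun B hB hBb h0 => ?_, fun B hB hBb => h2 hB hBb⟩
  rw [h2 hB hBb, setLIntegral_measure_zero _ _ h0, mul_zero]
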